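/- For every uncountable regular cardinal $\kappa$ there is a dense linearly ordered set (chain) $(X,\le)$ without a least and without a greatest element, of cardinality $|X|=\kappa$, which is epimorphism-rigid: every surjective map $f\colon X\to X$ such that $x\le y$ implies $f(x)\le f(y)$ for all $x,y\in X$ is the identity map of $X$. -/

import Mathlib

universe u

/-- An epimorphism of the chain `(X, ≤)`: a surjective map `X → X` that preserves `≤`. -/
def IsChainEpimorphism {X : Type*} [LinearOrder X] (f : X → X) : Prop :=
  Monotone f ∧ Function.Surjective f

/-- A chain is epimorphism-rigid if the identity is its only epimorphism. -/
def EpimorphismRigid (X : Type*) [LinearOrder X] : Prop :=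
  ∀ f : X → X, IsChainEpimorphism f → f = id

/-! The chain is a tree of finite sequences over κ: each lies above its extensions and siblings are
ordered by index, so the children of a branching ("free") node s are cofinal below s in type κ. A
child s⌢α with α in a stationary set S s of limits is a leaf, hence the supremum of its earlier
siblings; at other limits α there is no such supremum, since s⌢α and its extensions have no least
element. So the order to the left of s determines S s modulo a club, and the sets S s are pairwise
disjoint.

Let f be an epimorphism and y free. No set smaller than κ is cofinal in {f < y}, which forces its
complement to have a least element z that is free (`Node.exists_isLeast_compl`), and f z = y. On a
club of α, f interleaves the first α children of z with those of y, and surjectivity transports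
suprema; so some α lies in both S z and S y, and z = y (`Node.eq_of_epimorphism`). The fixed free
nodes are dense, so f is the identity. -/

open Cardinal Order

/-! ### Stationary sets and their splitting -/

/-- `S` contains a closure point of every function; for the order type of an uncountable regular
cardinal this is stationarity. -/
def HitsClosurePoints {ι : Type*} [LT ι] (S : Set ι) : Prop :=
  ∀ h : ι → ι, ∃ α ∈ S, ∀ β < α, h β < α

/-- Shape of the well-order of a regular cardinal `κ`: proper initial segments are smaller than
`κ` and sets smaller than `κ` are bounded. -/
structure IsRegularOrder (ι : Type u) [LinearOrder ι] (κ : Cardinal.{u}) : Prop where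
  mk_eq : #ι = κ
  mk_Iic_lt : ∀ a : ι, #(Set.Iic a) < κ
  exists_gt : ∀ A : Set ι, #A < κ → ∃ b, ∀ a ∈ A, a < b

theorem isRegularOrder_toType {κ : Cardinal.{u}} (hκ : κ.IsRegular) :
    IsRegularOrder κ.ord.ToType κ where
  mk_eq := mk_ord_toType κ
  mk_Iic_lt a := by
    rw [← Set.Iio_insert]
    exact (mk_insert_le).trans_lt
      (add_lt_of_lt hκ.aleph0_le (by simpa using Cardinal.mk_Iio_lt a (by simp)) (one_lt_aleph0.trans_le hκ.aleph0_le))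
  exists_gt A hA := by
    have := noMaxOrder hκ.aleph0_le
    by_contra! h
    have hc : IsCofinal A := fun b => by
      obtain ⟨a, ha, hb⟩ := h b
      exact ⟨a, ha, hb⟩
    have h1 := Order.cof_le hc
    rw [Ordinal.cof_toType, hκ.cof_ord] at h1
    exact absurd hA h1.not_gt

namespace IsRegularOrder

variable {ι : Type u} [LinearOrder ι] {κ : Cardinal.{u}}

theorem exists_gt_image (H : IsRegularOrder ι κ) (g : ι → ι) (a : ι) :
    ∃ b, ∀ x ≤ a, g x < b := by
  obtain ⟨b, hb⟩ := H.exists_gt (g '' Set.Iic a) (mk_image_le.trans_lt (H.mk_Iic_lt a))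
  exact ⟨b, fun x hx => hb _ ⟨x, hx, rfl⟩⟩

theorem exists_gt_range (H : IsRegularOrder ι κ) (hκ : ℵ₀ < κ) (g : ℕ → ι) :
    ∃ b, ∀ n, g n < b := by
  obtain ⟨b, hb⟩ := H.exists_gt (Set.range g)
    ((Cardinal.le_aleph0_iff_set_countable.2 (Set.countable_range g)).trans_lt hκ)
  exact ⟨b, fun n => hb _ ⟨n, rfl⟩⟩

/-- Every function has a closure point that is the supremum of an increasing sequence. -/
theorem exists_closurePoint [WellFoundedLT ι] [Nonempty ι] (H : IsRegularOrder ι κ) (hκ : ℵ₀ < κ)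
    (h : ι → ι) : ∃ α, (∀ β < α, h β < α) ∧
      ∃ a : ℕ → ι, (∀ n, a n < α) ∧ ∀ β < α, ∃ n, β < a n := by
  have hg : ∀ a, ∃ b, a < b ∧ ∀ x ≤ a, h x < b := fun a => by
    obtain ⟨b, hb⟩ := H.exists_gt_image (fun x => max x (h x)) a
    exact ⟨b, (le_max_left _ _).trans_lt (hb a le_rfl),
      fun x hx => (le_max_right _ _).trans_lt (hb x hx)⟩
  choose g hg1 hg2 using hg
  let a : ℕ → ι := fun n => g^[n] (Classical.arbitrary ι)
  have ha : ∀ n, a (n + 1) = g (a n) := fun n => Function.iterate_succ_apply' g n _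
  obtain ⟨b, hb⟩ := H.exists_gt_range hκ a
  obtain ⟨α, hα, hmin⟩ := wellFounded_lt.has_min {b | ∀ n, a n < b} ⟨b, hb⟩
  have hcof : ∀ β < α, ∃ n, β < a n := fun β hβ => by
    by_contra! hn
    exact hmin β (fun n => (ha n ▸ hg1 (a n)).trans_le (hn (n + 1))) hβ
  refine ⟨α, fun β hβ => ?_, a, hα, hcof⟩
  obtain ⟨n, hn⟩ := hcof β hβ
  exact (ha n ▸ hg2 (a n) β hn.le).trans (hα (n + 1))

/-- There are `κ` pairwise disjoint stationary sets of limit elements. -/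
theorem exists_disjoint_hitsClosurePoints [WellFoundedLT ι] [Nonempty ι]
    (H : IsRegularOrder ι κ) (hκ : ℵ₀ < κ) :
    ∃ T : ι → Set ι, (∀ i, HitsClosurePoints (T i)) ∧
      (∀ i j α, α ∈ T i → α ∈ T j → i = j) ∧
      ∀ i, ∀ α ∈ T i, (∃ β, β < α) ∧ ∀ β < α, ∃ γ, β < γ ∧ γ < α := by
  have hlad : ∀ α : ι, ∃ a : ℕ → ι, (∃ a : ℕ → ι, (∀ n, a n < α) ∧ ∀ β < α, ∃ n, β < a n) →
      (∀ n, a n < α) ∧ ∀ β < α, ∃ n, β < a n := fun α => by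
    by_cases h : ∃ a : ℕ → ι, (∀ n, a n < α) ∧ ∀ β < α, ∃ n, β < a n
    · exact ⟨h.choose, fun _ => h.choose_spec⟩
    · exact ⟨fun _ => α, fun h' => absurd h' h⟩
  choose a ha using hlad
  let S : Set ι := {α | (∀ n, a α n < α) ∧ ∀ β < α, ∃ n, β < a α n}
  have hS : HitsClosurePoints S := fun h => by
    obtain ⟨α, hα, hex⟩ := H.exists_closurePoint hκ h
    exact ⟨α, ha α hex, hα⟩
  -- If every n failed at some `η n`, a suitable closure point α above all `η n` would have a ladder
  -- passing their bound η'.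
  obtain ⟨n, hn⟩ : ∃ n, ∀ η, HitsClosurePoints {α | α ∈ S ∧ η ≤ a α n} := by
    by_contra! hcon
    simp only [HitsClosurePoints, not_forall] at hcon
    choose η h hh using hcon
    obtain ⟨η', hη'⟩ := H.exists_gt_range hκ η
    have hsup : ∀ β, ∃ b, (∀ n, h n β < b) ∧ η' < b := fun β => by
      obtain ⟨b, hb⟩ := H.exists_gt_range hκ (fun n => max (h n β) η')
      exact ⟨b, fun n => (le_max_left _ _).trans_lt (hb n), (le_max_right _ _).trans_lt (hb 0)⟩
    choose g hg1 hg2 using hsup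
    obtain ⟨α, hα, hcl⟩ := hS g
    obtain ⟨n, hn⟩ := hα.2 η' ((hg2 _).trans (hcl _ (hα.1 0)))
    exact hh n ⟨α, ⟨hα, ((hη' n).trans hn).le⟩, fun β hβ => (hg1 β n).trans (hcl β hβ)⟩
  -- Pressing down: `a α n` is regressive in α, so its stationary fibres occur at unboundedly many
  -- values.
  let Γ : Set ι := {γ | HitsClosurePoints {α | α ∈ S ∧ a α n = γ}}
  have hΓ : ∀ η, ∃ γ ∈ Γ, η ≤ γ := fun η => by
    by_contra! hcon
    have hbad : ∀ γ, ∃ h : ι → ι, η ≤ γ → ∀ α ∈ S, a α n = γ → ∃ β < α, α ≤ h β := fun γ => by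
      by_cases hγ : η ≤ γ
      · have : γ ∉ Γ := fun h => (hcon γ h).not_ge hγ
        simp only [Γ, Set.mem_ofPred_eq, HitsClosurePoints, not_forall] at this
        obtain ⟨h, hh⟩ := this
        refine ⟨h, fun _ α hα hαγ => ?_⟩
        by_contra! hc
        exact hh ⟨α, ⟨hα, hαγ⟩, hc⟩
      · exact ⟨id, fun h => absurd h hγ⟩
    choose h hh using hbad
    -- Diagonal intersection: a closure point α of `g` is closed under `h γ` for all γ < α at once.
    have hdiag : ∀ m, ∃ b, ∀ γ ≤ m, ∀ β ≤ m, h γ β < b := fun m => by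
      choose c hc using fun γ => H.exists_gt_image (h γ) m
      obtain ⟨b, hb⟩ := H.exists_gt_image c m
      exact ⟨b, fun γ hγ β hβ => (hc γ β hβ).trans (hb γ hγ)⟩
    choose g hg using hdiag
    obtain ⟨α, ⟨hα, hηα⟩, hcl⟩ := hn η g
    obtain ⟨β, hβ, hle⟩ := hh _ hηα α hα rfl
    exact hle.not_gt ((hg (max (a α n) β) _ (le_max_left _ _) _ (le_max_right _ _)).trans
      (hcl _ (max_lt (hα.1 n) hβ)))
  have hmk : #Γ = #ι := by
    refine (mk_set_le Γ).antisymm (le_of_not_gt fun hlt => ?_)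
    obtain ⟨b, hb⟩ := H.exists_gt Γ (H.mk_eq ▸ hlt)
    obtain ⟨γ, hγ, hle⟩ := hΓ b
    exact (hb γ hγ).not_ge hle
  obtain ⟨e⟩ := Cardinal.eq.1 hmk
  refine ⟨fun i => {α | α ∈ S ∧ a α n = e.symm i}, fun i => (e.symm i).2, ?_, ?_⟩
  · rintro i j α ⟨-, hi⟩ ⟨-, hj⟩
    exact e.symm.injective (Subtype.ext (hi.symm.trans hj))
  · rintro i α ⟨hα, -⟩
    refine ⟨⟨_, hα.1 0⟩, fun β hβ => ?_⟩
    obtain ⟨m, hm⟩ := hα.2 β hβ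
    exact ⟨_, hm, hα.1 m⟩

end IsRegularOrder

/-! ### The order on finite sequences -/

/-- Compares lists lexicographically, with every list above its proper extensions. -/
def tailKey {ι : Type*} (s : List ι) : (List ιᵒᵈ)ᵒᵈ :=
  OrderDual.toDual (s.map OrderDual.toDual)

theorem tailKey_injective {ι : Type*} : Function.Injective (tailKey (ι := ι)) := fun _ _ h =>
  List.map_injective_iff.2 OrderDual.toDual.injective (OrderDual.toDual.injective h)

section TailKey

variable {ι : Type*} [LinearOrder ι]

theorem tailKey_lt_iff {x y : List ι} : tailKey x < tailKey y ↔
    (∃ a t, x = y ++ a :: t) ∨ ∃ p a b u v, a < b ∧ x = p ++ a :: u ∧ y = p ++ b :: v := by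
  change (y.map OrderDual.toDual) < (x.map OrderDual.toDual) ↔ _
  induction y generalizing x with
  | nil => cases x <;> simp
  | cons b v ih =>
    cases x with
    | nil => simp
    | cons a u =>
      rw [List.map_cons, List.map_cons, List.cons_lt_cons_iff, ih, OrderDual.toDual_lt_toDual,
        OrderDual.toDual.injective.eq_iff]
      constructor
      · rintro (h | ⟨rfl, ⟨c, t, rfl⟩ | ⟨p, c, d, u', v', h, rfl, rfl⟩⟩)
        · exact .inr ⟨[], a, b, u, v, h, rfl, rfl⟩
        · exact .inl ⟨c, t, rfl⟩
        · exact .inr ⟨b :: p, c, d, u', v', h, rfl, rfl⟩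
      · rintro (⟨c, t, h⟩ | ⟨p, c, d, u', v', h, hx, hy⟩)
        · obtain ⟨rfl, rfl⟩ := List.cons.inj h
          exact .inr ⟨rfl, .inl ⟨c, t, rfl⟩⟩
        · cases p with
          | nil =>
            obtain ⟨rfl, rfl⟩ := List.cons.inj hx
            obtain ⟨rfl, rfl⟩ := List.cons.inj hy
            exact .inl h
          | cons e p =>
            obtain ⟨rfl, rfl⟩ := List.cons.inj hx
            obtain ⟨rfl, rfl⟩ := List.cons.inj hy
            exact .inr ⟨rfl, .inr ⟨p, c, d, u', v', h, rfl, rfl⟩⟩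

theorem tailKey_append_lt (y : List ι) (a : ι) (t : List ι) :
    tailKey (y ++ a :: t) < tailKey y :=
  tailKey_lt_iff.2 (.inl ⟨a, t, rfl⟩)

theorem tailKey_append_le (y t : List ι) : tailKey (y ++ t) ≤ tailKey y := by
  cases t with
  | nil => simp
  | cons a t => exact (tailKey_append_lt y a t).le

theorem tailKey_branch_lt (p : List ι) {a b : ι} (h : a < b) (u v : List ι) :
    tailKey (p ++ a :: u) < tailKey (p ++ b :: v) :=
  tailKey_lt_iff.2 (.inr ⟨p, a, b, u, v, h, rfl, rfl⟩)

/-- The children of a list are cofinal below it. -/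
theorem exists_tailKey_lt_append [NoMaxOrder ι] [Nonempty ι] {x y : List ι}
    (h : tailKey x < tailKey y) : ∃ a, tailKey x < tailKey (y ++ [a]) := by
  rcases tailKey_lt_iff.1 h with ⟨a, t, rfl⟩ | ⟨p, a, b, u, v, hab, rfl, rfl⟩
  · obtain ⟨b, hb⟩ := exists_gt a
    exact ⟨b, tailKey_branch_lt y hb t []⟩
  · refine ⟨Classical.arbitrary ι, ?_⟩
    rw [List.append_assoc, List.cons_append]
    exact tailKey_branch_lt p hab _ _

/-- Below a child with limit index, a list extends the child or is below an earlier child. -/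
theorem extends_or_lt_of_lt {x y : List ι} {α : ι} (hbot : ∃ β, β < α)
    (hlim : ∀ β < α, ∃ γ, β < γ ∧ γ < α) (h : tailKey x < tailKey (y ++ [α])) :
    (∃ a t, x = y ++ [α] ++ a :: t) ∨ ∃ γ < α, tailKey x < tailKey (y ++ [γ]) := by
  rcases tailKey_lt_iff.1 h with h | ⟨p, a, b, u, v, hab, rfl, hy⟩
  · exact .inl h
  right
  rcases List.eq_nil_or_concat v with rfl | ⟨v, c, rfl⟩
  · obtain ⟨rfl, hb⟩ := List.append_inj' hy rfl
    obtain rfl : α = b := by simpa using hb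
    obtain ⟨γ, h1, h2⟩ := hlim a hab
    exact ⟨γ, h2, tailKey_branch_lt _ h1 _ _⟩
  · obtain ⟨β, hβ⟩ := hbot
    have hy' : y = p ++ b :: v := by
      have : y ++ [α] = (p ++ b :: v) ++ [c] := by simpa using hy
      exact (List.append_inj' this rfl).1
    refine ⟨β, hβ, ?_⟩
    rw [hy', List.append_assoc, List.cons_append]
    exact tailKey_branch_lt p hab _ _

end TailKey

/-! ### Free sequences and the chain of nodes -/

/-- No entry of `s` lies in the set that `S` attaches to the part of `s` before it. -/
def IsFree {ι : Type*} (S : List ι → Set ι) (s : List ι) : Prop :=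
  ∀ p a t, s = p ++ a :: t → a ∉ S p

section IsFree

variable {ι : Type*} {S : List ι → Set ι}

theorem isFree_nil : IsFree S [] := fun p a t h => by simp at h

theorem IsFree.of_append {s t : List ι} (h : IsFree S (s ++ t)) : IsFree S s :=
  fun p a u hs => h p a (u ++ t) (by simp [hs])

theorem isFree_concat {s : List ι} {a : ι} :
    IsFree S (s ++ [a]) ↔ IsFree S s ∧ a ∉ S s := by
  refine ⟨fun h => ⟨h.of_append, h s a [] rfl⟩, fun ⟨h, ha⟩ p b t hs => ?_⟩
  rcases List.eq_nil_or_concat t with rfl | ⟨t, c, rfl⟩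
  · obtain ⟨rfl, hb⟩ := List.append_inj' hs rfl
    obtain rfl : a = b := by simpa using hb
    exact ha
  · have : s ++ [a] = (p ++ b :: t) ++ [c] := by simpa using hs
    exact h p b t (List.append_inj' this rfl).1

end IsFree

/-- The nonempty lists whose entries, except possibly the last, avoid the sets given by `S`. -/
structure Node {ι : Type u} (S : List ι → Set ι) where
  val : List ι
  property : ∃ p a, IsFree S p ∧ val = p ++ [a]

namespace Node

variable {ι : Type u} {S : List ι → Set ι}

theorem val_injective : Function.Injective (Node.val (S := S)) := by
  rintro ⟨x, hx⟩ ⟨y, hy⟩ rfl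
  rfl

noncomputable instance [LinearOrder ι] : LinearOrder (Node S) :=
  LinearOrder.lift' (fun x : Node S => tailKey x.val)
    (tailKey_injective.comp val_injective)

/-- A nonempty free list as a node. -/
def ofFree (s : List ι) (hs : IsFree S s) (hne : s ≠ []) : Node S :=
  ⟨s, s.dropLast, s.getLast hne, by
    rw [← List.dropLast_append_getLast hne] at hs
    exact hs.of_append, (List.dropLast_append_getLast hne).symm⟩

/-- The child of a free list. -/
def child (p : List ι) (hp : IsFree S p) (a : ι) : Node S := ⟨p ++ [a], p, a, hp, rfl⟩

theorem isFree_of_val_eq {x : Node S} {p : List ι} {a : ι} {t : List ι}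
    (h : x.val = p ++ a :: t) : IsFree S p := by
  obtain ⟨q, b, hq, hx⟩ := x.property
  rw [h] at hx
  rcases List.eq_nil_or_concat t with rfl | ⟨t, c, rfl⟩
  · obtain ⟨rfl, -⟩ := List.append_inj' hx rfl
    exact hq
  · have : (p ++ a :: t) ++ [c] = q ++ [b] := by simpa using hx
    rw [← (List.append_inj' this rfl).1] at hq
    exact hq.of_append

variable [LinearOrder ι]

theorem lt_iff {x y : Node S} : x < y ↔ tailKey x.val < tailKey y.val := Iff.rfl

theorem le_iff {x y : Node S} : x ≤ y ↔ tailKey x.val ≤ tailKey y.val := Iff.rfl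

theorem child_lt_child {p : List ι} (hp : IsFree S p) {a b : ι} (h : a < b) :
    child p hp a < child p hp b :=
  tailKey_branch_lt p h [] []

theorem child_lt_self {x : Node S} (hx : IsFree S x.val) (a : ι) : child x.val hx a < x :=
  tailKey_append_lt x.val a []

theorem exists_lt_child [NoMaxOrder ι] [Nonempty ι] {x y : Node S} (hy : IsFree S y.val)
    (h : x < y) : ∃ a, x < child y.val hy a :=
  exists_tailKey_lt_append h

/-- A terminal node is the supremum of its earlier siblings. -/
theorem exists_lt_child_of_lt {p : List ι} (hp : IsFree S p) {α : ι} (hα : α ∈ S p)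
    (hbot : ∃ β, β < α) (hlim : ∀ β < α, ∃ γ, β < γ ∧ γ < α) {x : Node S}
    (h : x < child p hp α) : ∃ γ < α, x < child p hp γ := by
  rcases extends_or_lt_of_lt hbot hlim h with ⟨a, t, ht⟩ | h
  · exact absurd hα (isFree_concat.1 (isFree_of_val_eq ht)).2
  · exact h

/-! ### Cuts of large cofinality -/

/-- If no set smaller than `κ` is cofinal in a nonempty proper lower set,
then its complement has a least element, which is moreover free. -/
theorem exists_isLeast_compl [WellFoundedLT ι] {κ : Cardinal.{u}} (H : IsRegularOrder ι κ)
    (hreg : κ.IsRegular) (hκ : ℵ₀ < κ) {L : Set (Node S)} (hL : IsLowerSet L)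
    (hne : Lᶜ.Nonempty) (hcof : ∀ A ⊆ L, #A < κ → ∃ x ∈ L, ∀ a ∈ A, a < x) :
    ∃ z, IsLeast Lᶜ z ∧ IsFree S z.val := by
  by_contra! hno
  -- The branch that follows the cut: nodes above it with descendants below it. The empty list
  -- serves as root.
  let T : Set (List ι) := {s | (∀ x : Node S, x.val = s → x ∉ L) ∧
    ∃ x ∈ L, ∃ a t, x.val = s ++ a :: t}
  have hfree : ∀ s ∈ T, IsFree S s := fun s ⟨_, x, _, a, t, hx⟩ => isFree_of_val_eq hx
  have hnil : [] ∈ T := by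
    obtain ⟨x, hx, -⟩ := hcof ∅ (by simp) (by simpa using hreg.pos)
    refine ⟨fun x hx => ?_, x, hx, ?_⟩
    · obtain ⟨p, a, -, h⟩ := x.property
      simp [hx] at h
    · obtain ⟨p, a, -, h⟩ := x.property
      rw [h]
      cases p <;> simp
  have hlen : ∀ s ∈ T, ∀ t ∈ T, s.length = t.length → ¬ tailKey s < tailKey t := by
    rintro s hs t ⟨-, x, hx, c, w, hxt⟩ hst hlt
    rcases tailKey_lt_iff.1 hlt with ⟨a, u, rfl⟩ | ⟨p, a, b, u, v, hab, rfl, rfl⟩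
    · simp at hst
    · refine hs.1 (ofFree _ (hfree _ hs) (by simp)) rfl (hL ?_ hx)
      rw [le_iff, hxt, ofFree, List.append_assoc, List.cons_append]
      exact (tailKey_branch_lt p hab _ _).le
  have hinj : Set.InjOn List.length T := fun s hs t ht hst => by
    by_contra hne
    rcases lt_or_gt_of_ne (tailKey_injective.ne hne) with h | h
    · exact hlen s hs t ht hst h
    · exact hlen t ht s hs hst.symm h
  have hcount : #T < κ := by
    have := (Set.mapsTo_univ List.length T).countable_of_injOn hinj (Set.countable_univ)
    exact (Cardinal.le_aleph0_iff_set_countable.2 this).trans_lt hκ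
  -- If all children of s were in L, then s would be the excluded free least element, or L would be
  -- everything when s is the root.
  have hex : ∀ s : T, ∃ β, child s.1 (hfree _ s.2) β ∉ L := by
    rintro ⟨s, hs⟩
    by_contra! hall
    rcases eq_or_ne s [] with rfl | hs0
    · obtain ⟨u, hu⟩ := hne
      obtain ⟨p, a, -, h⟩ := u.property
      obtain ⟨b, t, hb⟩ : ∃ b t, u.val = b :: t := by
        rw [h]
        cases p <;> simp
      refine hu (hL ?_ (hall b))
      rw [le_iff, hb]
      exact tailKey_append_le [b] t
    · let z := ofFree s (hfree s hs) hs0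
      refine hno z ⟨hs.1 z rfl, fun u hu => ?_⟩ (hfree s hs)
      by_contra! hlt
      rcases tailKey_lt_iff.1 hlt with ⟨a, t, h⟩ | ⟨p, a, b', u', v, hab, h1, h2⟩
      · refine hu (hL ?_ (hall a))
        rw [le_iff, h]
        exact by simpa [child, z, ofFree] using tailKey_append_le (s ++ [a]) t
      · obtain ⟨x, hx, c, t, hxs⟩ := hs.2
        refine hu (hL ?_ hx)
        rw [le_iff, h1, hxs, show s = p ++ b' :: v from h2, List.append_assoc, List.cons_append]
        exact (tailKey_branch_lt p hab _ _).le
  have hmin : ∀ s : T, ∃ β, child s.1 (hfree _ s.2) β ∉ L ∧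
      ∀ γ < β, child s.1 (hfree _ s.2) γ ∈ L := fun s => by
    obtain ⟨β, hβ, hm⟩ := wellFounded_lt.has_min {β | child s.1 (hfree _ s.2) β ∉ L} (hex s)
    exact ⟨β, hβ, fun γ hγ => by_contra fun h => hm γ h hγ⟩
  choose β hβ hβmin using hmin
  -- Along the countable branch, collect the siblings left of the cut: fewer than κ nodes by
  -- regularity, yet cofinal in L by `hdom`.
  let A : Set (Node S) := ⋃ s : T, (fun γ => child s.1 (hfree _ s.2) γ) '' Set.Iio (β s)
  have hA : A ⊆ L := by
    rintro x hx
    obtain ⟨s, γ, hγ, rfl⟩ := Set.mem_iUnion.1 hx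
    exact hβmin s γ hγ
  have hAκ : #A < κ := by
    refine (card_iUnion_lt_iff_forall_of_isRegular hreg hcount).2 fun s => ?_
    exact mk_image_le.trans_lt ((mk_le_mk_of_subset Set.Iio_subset_Iic_self).trans_lt
      (H.mk_Iic_lt _))
  have hdom : ∀ t s, s ∈ T → ∀ x ∈ L, x.val = s ++ t → ∃ a ∈ A, x ≤ a := by
    intro t
    induction t with
    | nil => exact fun s hs x hx h => absurd hx (hs.1 x (by simpa using h))
    | cons γ t ih =>
      intro s hs x hx hxs
      rcases lt_trichotomy γ (β ⟨s, hs⟩) with h | h | h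
      · refine ⟨_, Set.mem_iUnion.2 ⟨⟨s, hs⟩, γ, h, rfl⟩, ?_⟩
        rw [le_iff, hxs]
        simpa [child] using tailKey_append_le (s ++ [γ]) t
      · have hout : ∀ y : Node S, y.val = s ++ [γ] → y ∉ L := fun y hy => by
          have : y = child s (hfree s hs) (β ⟨s, hs⟩) := val_injective (by simp [hy, child, h])
          exact this ▸ hβ ⟨s, hs⟩
        refine ih (s ++ [γ]) ⟨hout, x, hx, ?_⟩ x hx (by simp [hxs])
        cases t with
        | nil => exact absurd hx (hout x hxs)
        | cons a t => exact ⟨a, t, by simp [hxs]⟩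
      · refine absurd (hL ?_ hx) (hβ ⟨s, hs⟩)
        rw [le_iff, hxs]
        exact (tailKey_branch_lt s h _ _).le
  obtain ⟨x, hx, hxA⟩ := hcof A hA hAκ
  obtain ⟨a, ha, hxa⟩ := hdom x.val [] hnil x hx rfl
  exact (hxA a ha).not_ge hxa

end Node

/-! ### Density and rigidity -/

/-- Pairwise disjoint stationary sets of limit elements, indexed by lists. -/
structure IsDisjointHittingFamily {ι : Type u} [LinearOrder ι] (S : List ι → Set ι) : Prop where
  hits : ∀ s, HitsClosurePoints (S s)
  disjoint : ∀ s t α, α ∈ S s → α ∈ S t → s = t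
  exists_lt : ∀ s, ∀ α ∈ S s, ∃ β, β < α
  exists_between : ∀ s, ∀ α ∈ S s, ∀ β < α, ∃ γ, β < γ ∧ γ < α

namespace Node

variable {ι : Type u} {S : List ι → Set ι}

theorem eq_child (x : Node S) : ∃ p a, ∃ hp : IsFree S p, x = child p hp a := by
  obtain ⟨p, a, hp, h⟩ := x.property
  exact ⟨p, a, hp, val_injective h⟩

theorem mk_eq [LinearOrder ι] {κ : Cardinal.{u}} (H : IsRegularOrder ι κ) (hκ : ℵ₀ < κ) : #(Node S) = κ := by
  have : Infinite ι := infinite_iff.2 (hκ.le.trans H.mk_eq.ge)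
  rw [← H.mk_eq]
  refine ((mk_le_of_injective val_injective).trans (mk_list_eq_mk ι).le).antisymm
    (mk_le_of_injective (f := child (S := S) [] isFree_nil) fun a b h => ?_)
  simpa [child] using congrArg Node.val h

variable [LinearOrder ι] [WellFoundedLT ι]

/-- Successors are not limits, so they always give branching children. -/
theorem exists_succ_notMem [NoMaxOrder ι] (hS : IsDisjointHittingFamily S) (α : ι) :
    ∃ β, α < β ∧ (∀ γ, α < γ → β ≤ γ) ∧ ∀ s, β ∉ S s := by
  obtain ⟨β, hβ, hmin⟩ := wellFounded_lt.has_min (Set.Ioi α) Set.nonempty_Ioi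
  refine ⟨β, hβ, fun γ hγ => not_lt.1 (hmin γ hγ), fun s hs => ?_⟩
  obtain ⟨γ, h1, h2⟩ := hS.exists_between s β hs α hβ
  exact hmin γ h1 h2

theorem exists_bot_notMem [Nonempty ι] (hS : IsDisjointHittingFamily S) :
    ∃ b : ι, (∀ a, b ≤ a) ∧ ∀ s, b ∉ S s := by
  obtain ⟨b, -, hmin⟩ := wellFounded_lt.has_min (Set.univ : Set ι) Set.univ_nonempty
  refine ⟨b, fun a => not_lt.1 (hmin a trivial), fun s hs => ?_⟩
  obtain ⟨β, hβ⟩ := hS.exists_lt s b hs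
  exact hmin β trivial hβ

/-- Below every child of a free list there is a child of a free extension of that list. -/
theorem exists_child_lt [Nonempty ι] (hS : IsDisjointHittingFamily S) {p : List ι} (hp : IsFree S p) (δ : ι) :
    ∃ b, ∃ hq : IsFree S (p ++ [b]), child (p ++ [b]) hq b < child p hp δ := by
  obtain ⟨b, hb, hbS⟩ := exists_bot_notMem hS
  have hq : IsFree S (p ++ [b]) := isFree_concat.2 ⟨hp, hbS p⟩
  refine ⟨b, hq, ?_⟩
  rw [lt_iff]
  rcases (hb δ).eq_or_lt with rfl | h
  · exact tailKey_append_lt (p ++ [b]) b []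
  · simpa [child] using tailKey_branch_lt p h [b] []

/-- Free nodes are order dense. -/
theorem exists_free_between [NoMaxOrder ι] [Nonempty ι] (hS : IsDisjointHittingFamily S) {x y : Node S} (h : x < y) :
    ∃ z, IsFree S z.val ∧ x < z ∧ z < y := by
  have key : ∀ (p : List ι) (hp : IsFree S p) (a : ι), x < child p hp a →
      ∃ β, (∀ γ, a < γ → β ≤ γ) ∧ IsFree S (child p hp β).val ∧ x < child p hp β := by
    intro p hp a ha
    obtain ⟨β, hβ, hmin, hβS⟩ := exists_succ_notMem hS a
    exact ⟨β, hmin, isFree_concat.2 ⟨hp, hβS p⟩, ha.trans (child_lt_child hp hβ)⟩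
  obtain ⟨p, α, hp, rfl⟩ := eq_child y
  by_cases hα : α ∈ S p
  · obtain ⟨γ, hγ, hx⟩ := exists_lt_child_of_lt hp hα (hS.exists_lt p α hα)
      (hS.exists_between p α hα) h
    obtain ⟨β, hβ, hf, hxβ⟩ := key p hp γ hx
    obtain ⟨δ, h1, h2⟩ := hS.exists_between p α hα γ hγ
    exact ⟨_, hf, hxβ, child_lt_child hp ((hβ δ h1).trans_lt h2)⟩
  · have hf : IsFree S (child p hp α).val := isFree_concat.2 ⟨hp, hα⟩
    obtain ⟨a, ha⟩ := exists_lt_child hf h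
    obtain ⟨β, -, hfβ, hxβ⟩ := key _ hf a ha
    exact ⟨_, hfβ, hxβ, child_lt_self hf β⟩

/-- If the free node `y` is the image of the free node `z` under an epimorphism that maps
everything below `z` below `y`, then `z = y`. -/
theorem eq_of_epimorphism [NoMaxOrder ι] [Nonempty ι] (hS : IsDisjointHittingFamily S) {f : Node S → Node S}
    (hf : IsChainEpimorphism f) {y z : Node S} (hy : IsFree S y.val) (hz : IsFree S z.val)
    (hzy : ∀ x, x < z ↔ f x < y) : z = y := by
  obtain ⟨hmono, hsurj⟩ := hf
  have h1 : ∀ β, ∃ γ, f (child z.val hz β) < child y.val hy γ := fun β =>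
    exists_lt_child hy ((hzy _).1 (child_lt_self hz β))
  have h2 : ∀ γ, ∃ β, child y.val hy γ ≤ f (child z.val hz β) := fun γ => by
    obtain ⟨v, hv⟩ := hsurj (child y.val hy γ)
    obtain ⟨β, hβ⟩ := exists_lt_child hz ((hzy v).2 (hv ▸ child_lt_self hy γ))
    exact ⟨β, hv ▸ hmono hβ.le⟩
  choose g1 hg1 using h1
  choose g2 hg2 using h2
  -- Closure under both bounds makes the images of the children of z before α and the children of y
  -- before α mutually cofinal.
  obtain ⟨α, hα, hcl⟩ := hS.hits z.val fun β => max (g1 β) (g2 β)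
  have hcl1 : ∀ β < α, g1 β < α := fun β hβ => (le_max_left _ _).trans_lt (hcl β hβ)
  have hcl2 : ∀ β < α, g2 β < α := fun β hβ => (le_max_right _ _).trans_lt (hcl β hβ)
  have hlim := hS.exists_between _ α hα
  have hbot := hS.exists_lt _ α hα
  refine val_injective (hS.disjoint _ _ α hα (by_contra fun hα' => ?_))
  -- With `hub`: the image of the leaf z⌢α is the supremum of the children of y before α.
  have hleast : ∀ w, (∀ γ < α, child y.val hy γ < w) → f (child z.val hz α) ≤ w := fun w hw => by
    obtain ⟨v, rfl⟩ := hsurj w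
    refine hmono (le_of_not_gt fun hlt => ?_)
    obtain ⟨β, hβ, hvβ⟩ := exists_lt_child_of_lt hz hα hbot hlim hlt
    exact ((hmono hvβ.le).trans_lt (hg1 β)).not_gt (hw _ (hcl1 β hβ))
  have hub : ∀ γ < α, child y.val hy γ < f (child z.val hz α) := fun γ hγ => by
    obtain ⟨δ, hγδ, hδ⟩ := hlim γ hγ
    exact (child_lt_child hy hγδ).trans_le ((hg2 δ).trans
      (hmono (child_lt_child hz (hcl2 δ hδ)).le))
  have hyα : IsFree S (y.val ++ [α]) := isFree_concat.2 ⟨hy, hα'⟩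
  obtain ⟨b, -, -⟩ := exists_bot_notMem hS
  have hm : f (child z.val hz α) < child y.val hy α := by
    refine (hleast (child _ hyα b) fun γ hγ => ?_).trans_lt (tailKey_append_lt (y.val ++ [α]) b [])
    rw [lt_iff]
    simpa [child] using tailKey_branch_lt y.val hγ [] [b]
  rcases extends_or_lt_of_lt hbot hlim hm with ⟨a, t, ht⟩ | ⟨γ, hγ, hlt⟩
  -- Within the subtree of y⌢α one can always descend to a smaller upper bound.
  · obtain ⟨p, δ, hp, hpδ⟩ := eq_child (f (child z.val hz α))
    obtain ⟨b, hq, hlt⟩ := exists_child_lt hS hp δ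
    refine (hleast _ fun γ hγ => ?_).not_gt (hpδ ▸ hlt)
    obtain ⟨u, hu⟩ : ∃ u, p = y.val ++ [α] ++ u := by
      rw [hpδ] at ht
      rcases List.eq_nil_or_concat t with rfl | ⟨t, c, rfl⟩
      · exact ⟨[], by simpa using (List.append_inj' ht rfl).1⟩
      · have : p ++ [δ] = (y.val ++ [α] ++ a :: t) ++ [c] := by simpa [child] using ht
        exact ⟨a :: t, (List.append_inj' this rfl).1⟩
    rw [lt_iff]
    simpa [child, hu] using tailKey_branch_lt y.val hγ [] (u ++ [b, b])
  · exact (hub γ hγ).not_gt hlt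

theorem epimorphismRigid {κ : Cardinal.{u}} (H : IsRegularOrder ι κ) (hreg : κ.IsRegular)
    (hκ : ℵ₀ < κ) [NoMaxOrder ι] [Nonempty ι] (hS : IsDisjointHittingFamily S) :
    EpimorphismRigid (Node S) := by
  intro f hf
  have hfix : ∀ y : Node S, IsFree S y.val → f y = y := fun y hy => by
    -- Fewer than κ images below y are bounded by one child of y, whose preimage bounds A.
    have hcof : ∀ A ⊆ {x | f x < y}, #A < κ → ∃ x ∈ {x | f x < y}, ∀ a ∈ A, a < x := by
      intro A hA hAκ
      choose g hg using fun a : A => exists_lt_child hy (hA a.2)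
      obtain ⟨α, hα⟩ := H.exists_gt (Set.range g) (mk_range_le.trans_lt hAκ)
      obtain ⟨x, hx⟩ := hf.2 (child y.val hy α)
      refine ⟨x, (hx ▸ child_lt_self hy α : f x < y), fun a ha => ?_⟩
      refine hf.1.reflect_lt (hx ▸ (hg ⟨a, ha⟩).trans (child_lt_child hy (hα _ ⟨_, rfl⟩)))
    obtain ⟨x, hx⟩ := hf.2 y
    obtain ⟨z, hz, hzf⟩ := exists_isLeast_compl (L := {x | f x < y}) H hreg hκ
      (fun a b hba ha => (hf.1 hba).trans_lt ha) ⟨x, by simp [hx]⟩ hcof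
    have hzy : ∀ x, x < z ↔ f x < y := fun x =>
      ⟨fun h => by_contra fun hn => (hz.2 hn).not_gt h,
        fun h => lt_of_not_ge fun hn => hz.1 ((hf.1 hn).trans_lt h)⟩
    have hle : f z ≤ y := hx ▸ hf.1 (hz.2 (by simp [hx]))
    have hfz : f z = y := hle.antisymm (not_lt.1 hz.1)
    rwa [eq_of_epimorphism hS hf hy hzf hzy] at hfz
  funext x
  rcases lt_trichotomy (f x) x with h | h | h
  · obtain ⟨z, hz, h1, h2⟩ := exists_free_between hS h
    exact absurd (hf.1 h2.le) (by rw [hfix z hz]; exact h1.not_ge)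
  · exact h
  · obtain ⟨z, hz, h1, h2⟩ := exists_free_between hS h
    exact absurd (hf.1 h1.le) (by rw [hfix z hz]; exact h2.not_ge)

end Node

/-! ### Assembling the chain -/

theorem IsRegularOrder.exists_isDisjointHittingFamily {ι : Type u} [LinearOrder ι]
    [WellFoundedLT ι] {κ : Cardinal.{u}} (H : IsRegularOrder ι κ) (hκ : ℵ₀ < κ) :
    ∃ S : List ι → Set ι, IsDisjointHittingFamily S := by
  have : Infinite ι := infinite_iff.2 (hκ.le.trans H.mk_eq.ge)
  obtain ⟨T, hT, hdisj, hlim⟩ := H.exists_disjoint_hitsClosurePoints hκ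
  obtain ⟨e⟩ := Cardinal.eq.1 (mk_list_eq_mk ι)
  exact ⟨fun s => T (e s), fun s => hT _, fun s t α hs ht => e.injective (hdisj _ _ α hs ht),
    fun s α hα => (hlim _ α hα).1, fun s α hα => (hlim _ α hα).2⟩

theorem theorem5p1 (κ : Cardinal.{u}) (hreg : κ.IsRegular)
    (hunc : Cardinal.aleph0 < κ) :
    ∃ (X : Type u) (_ : LinearOrder X),
      DenselyOrdered X ∧ NoMinOrder X ∧ NoMaxOrder X ∧
        Cardinal.mk X = κ ∧ EpimorphismRigid X := by
  have H := isRegularOrder_toType hreg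
  have : NoMaxOrder κ.ord.ToType := noMaxOrder hreg.aleph0_le
  have : Infinite κ.ord.ToType := infinite_iff.2 (hunc.le.trans H.mk_eq.ge)
  obtain ⟨S, hS⟩ := H.exists_isDisjointHittingFamily hunc
  refine ⟨Node S, inferInstance, ⟨fun x y h => ?_⟩, ⟨fun x => ?_⟩, ⟨fun x => ?_⟩,
    Node.mk_eq H hunc, Node.epimorphismRigid H hreg hunc hS⟩
  · obtain ⟨z, -, h1, h2⟩ := Node.exists_free_between hS h
    exact ⟨z, h1, h2⟩
  · obtain ⟨p, a, hp, rfl⟩ := Node.eq_child x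
    obtain ⟨b, hq, h⟩ := Node.exists_child_lt hS hp a
    exact ⟨_, h⟩
  · obtain ⟨a, t, ht⟩ : ∃ a t, x.val = a :: t := by
      obtain ⟨p, a, -, h⟩ := x.property
      rw [h]
      cases p <;> simp
    obtain ⟨b, hb⟩ := exists_gt a
    refine ⟨Node.child [] isFree_nil b, ?_⟩
    rw [Node.lt_iff, ht]
    exact tailKey_branch_lt [] hb t []
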